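/- Let $a_n$ be the number of 3D rook paths from $(0,0,0)$ to $(n,n,n)$, that is, of finite sequences of moves, each a positive integer multiple of $(1,0,0)$, $(0,1,0)$ or $(0,0,1)$, with sum $(n,n,n)$, and let $G(x)=\sum_{n\ge 0}a_nx^n\in\mathbb{Q}[[x]]$. Put \[ g_2(x)=(1-4x)(1-60x+120x^2-64x^3),\qquad J(x)=\frac{g_2(x)^3}{1728\,(1-x)^2x^3(2-3x)^3(1-64x)}, \] \[ H(x)=\frac{1}{g_2(x)^{1/4}}\cdot{}_2F_1\!\left(\tfrac1{12},\tfrac5{12};1;\frac1{J(x)}\right),\qquad {}_2F_1(a,b;c;z)=\sum_{n\ge0}\frac{(a)_n(b)_n}{(c)_n}\frac{z^n}{n!}, \] where $g_2^{1/4}$ is the branch (formally, the series) with constant term $1$, and $1/J$ is expanded at $x=0$, where it vanishes. Then \[ G'(x)=\frac{1-x}{2(1+6x)}\Bigl((1-4x)H'(x)-4H(x)\Bigr), \] both as an identity in $\mathbb{Q}[[x]]$ and as an identity of convergent, complex differentiable functions of $x$ in a neighbourhood of $0$ in $\mathbb{C}$. -/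

import Mathlib

/-- The admissible moves of the 3D rook on `ℕ³`: positive integer multiples of the unit vectors
`(1,0,0)`, `(0,1,0)`, `(0,0,1)`. -/
def rookSteps : Set (Fin 3 → ℕ) :=
  {s | ∃ (i : Fin 3) (m : ℕ), 0 < m ∧ s = Pi.single i m}

/-- The rook paths from `(0,0,0)` to `p`, a path being its finite (possibly empty) sequence
of moves. -/
def rookPaths (p : Fin 3 → ℕ) : Set (List (Fin 3 → ℕ)) :=
  {l | (∀ s ∈ l, s ∈ rookSteps) ∧ l.sum = p}

/-- The set of rook paths to a given cell is finite, so that counting it is meaningful. -/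
theorem rookPaths_finite (p : Fin 3 → ℕ) : (rookPaths p).Finite := by
  have hfin : (Set.Iic p).Finite := Set.finite_Iic p
  have hlen := List.finite_length_le (Set.Iic p) (∑ i, p i)
  refine (hlen.image (List.map Subtype.val)).subset ?_
  rintro l ⟨hl, hsum⟩
  have hle : ∀ s ∈ l, s ∈ Set.Iic p := fun s hs => hsum ▸ List.single_le_sum (by simp) s hs
  refine ⟨l.attach.map fun s => ⟨s.1, hle s.1 s.2⟩, ?_, by simp [Function.comp_def]⟩
  have key : ∀ l : List (Fin 3 → ℕ), (∀ s ∈ l, s ∈ rookSteps) →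
      l.length ≤ ∑ i, l.sum i := by
    intro l
    induction l with
    | nil => simp
    | cons a t ih =>
      intro h
      have h1 := ih fun s hs => h s (List.mem_cons_of_mem _ hs)
      obtain ⟨i, m, hm, rfl⟩ := h a List.mem_cons_self
      have hsum1 : ∑ j, (Pi.single i m : Fin 3 → ℕ) j = m := by simp
      rw [List.length_cons, List.sum_cons]
      simp only [Pi.add_apply, Finset.sum_add_distrib]
      rw [hsum1]
      omega
  simpa [hsum] using key l hl

/-- The 3D diagonal rook sequence: the number `aₙ` of rook paths from `(0,0,0)` to `(n,n,n)`. -/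
noncomputable def diagonalRook (n : ℕ) : ℕ := (rookPaths fun _ => n).ncard

/-- `g₂ = (1 - 4x)(1 - 60x + 120x² - 64x³)`, in any commutative ring. -/
def g₂ {R : Type*} [CommRing R] (x : R) : R :=
  (1 - 4 * x) * (1 - 60 * x + 120 * x ^ 2 - 64 * x ^ 3)

/-- The denominator `1728 (1 - x)² x³ (2 - 3x)³ (1 - 64x)` of `J = g₂³ / denJ`. -/
def denJ {R : Type*} [CommRing R] (x : R) : R :=
  1728 * (1 - x) ^ 2 * x ^ 3 * (2 - 3 * x) ^ 3 * (1 - 64 * x)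

/-! ### Formal power series over `ℚ` -/

/-- The generating series `G = ∑ aₙ xⁿ ∈ ℚ⟦x⟧` of diagonal rook paths. -/
noncomputable def rookSeries : PowerSeries ℚ :=
  PowerSeries.mk fun n => (diagonalRook n : ℚ)

/-- The Gaussian hypergeometric series `₂F₁(a, b; c; x) ∈ ℚ⟦x⟧`. -/
noncomputable def hypergeometricSeries (a b c : ℚ) : PowerSeries ℚ :=
  PowerSeries.mk (ordinaryHypergeometricCoefficient a b c)

/-- The power `f ^ r ∈ ℚ⟦x⟧` of a series `f` with constant coefficient `1`, for a rational exponent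
`r`: the binomial series `∑ (r choose n) xⁿ` evaluated at `f - 1`. -/
noncomputable def seriesRpow (f : PowerSeries ℚ) (r : ℚ) : PowerSeries ℚ :=
  (PowerSeries.binomialSeries ℚ r).subst (f - 1)

/-- `1 / J ∈ ℚ⟦x⟧`. Here `g₂` has constant coefficient `1`, so `g₂³` is invertible; the constant
coefficient of `1 / J` is `0`. -/
noncomputable def invJSeries : PowerSeries ℚ :=
  denJ PowerSeries.X * (g₂ (PowerSeries.X : PowerSeries ℚ) ^ 3)⁻¹

/-- `H = g₂ ^ (-1/4) · ₂F₁(1/12, 5/12; 1; 1/J) ∈ ℚ⟦x⟧`. -/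
noncomputable def beukersHSeries : PowerSeries ℚ :=
  seriesRpow (g₂ PowerSeries.X) (-1 / 4) *
    ((hypergeometricSeries (1 / 12) (5 / 12) 1).subst invJSeries : PowerSeries ℚ)

/-! ### Analytic functions near `0` -/

/-- The sum `G(x) = ∑ aₙ xⁿ` of the generating series of diagonal rook paths. -/
noncomputable def rookFun (x : ℂ) : ℂ := ∑' n : ℕ, (diagonalRook n : ℂ) * x ^ n

/-- `J(x) = g₂(x)³ / (1728 (1 - x)² x³ (2 - 3x)³ (1 - 64x))`. At the pole `x = 0` of `J` the
conventions of division give `1 / beukersJ 0 = 0`, which is the value of the rational function `1 / J`. -/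
noncomputable def beukersJ (x : ℂ) : ℂ := g₂ x ^ 3 / denJ x

/-- `H(x) = g₂(x) ^ (-1/4) · ₂F₁(1/12, 5/12; 1; 1/J(x))`, with the principal branch of the fourth
root, which is the one with value `1` at `g₂(0) = 1`. -/
noncomputable def beukersH (x : ℂ) : ℂ :=
  1 / g₂ x ^ (1 / 4 : ℂ) * ordinaryHypergeometric (1 / 12 : ℂ) (5 / 12) 1 (1 / beukersJ x)

/-! Splitting off the first move shows that the trivariate count of rook paths is N/D, where N =
(1-x)(1-y)(1-z), D = 1 - 2e₁ + 3e₂ - 4e₃, and eᵢ are the elementary symmetric polynomials.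

On the coefficient at (n,n,n) all three Euler derivations θᵢ act as multiplication by n. So θ₀a +
θ₁b + θ₂c has zero diagonal whenever a + b + c = 0 (`diag_exact`). Modulo such terms, two explicit
rational identities (creative telescoping) yield a second order equation for u = diag(1/D)
(`ode_certificate`, `odeOp_diagInv`) and an expression of G' through u and u' (`num_certificate`,
`derivative_rookSeries`). The latter is the claimed formula with u in place of H.

It remains to see u = H. The equation has the double exponent 0 at the origin, so a power series
solution is fixed by its constant term (`eq_zero_of_odeOp`). H has constant term 1, like u, and
solves the same equation because that equation is a pullback of the hypergeometric one along 1/J,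
twisted by g₂^(-1/4) (`pullback_ode`).

The analytic statement follows by comparing Taylor series at 0. Convergence of G needs no estimate
of path counts: the right-hand side is analytic and has Taylor coefficients (n+1)aₙ₊₁. -/

/-! ### The rational generating function of rook paths -/

/-- The number of rook paths to `p`, as a trivariate power series. -/
noncomputable def rookCount : MvPowerSeries (Fin 3) ℚ := fun p => ((rookPaths p).ncard : ℚ)

open Classical in
/-- The indicator series of the rook steps. -/
noncomputable def rookStepSeries : MvPowerSeries (Fin 3) ℚ :=
  fun p => if (p : Fin 3 → ℕ) ∈ rookSteps then 1 else 0

open Classical in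
/-- The indicator series of the rook steps in direction `i`. -/
noncomputable def axisSeries (i : Fin 3) : MvPowerSeries (Fin 3) ℚ :=
  fun p => if ∃ m : ℕ, 0 < m ∧ p = Finsupp.single i m then 1 else 0

theorem zero_notMem_rookSteps : (0 : Fin 3 → ℕ) ∉ rookSteps := by
  rintro ⟨i, m, hm, h⟩
  have := congrFun h i
  simp at this
  omega

theorem rookPaths_zero : rookPaths 0 = {[]} := by
  ext l
  constructor
  · rintro ⟨hl, hs⟩
    rcases l with _ | ⟨a, t⟩
    · rfl
    · exfalso
      rw [List.sum_cons] at hs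
      have ha : a = 0 := by
        funext j
        have := congrFun hs j
        simp only [Pi.add_apply, Pi.zero_apply] at this ⊢
        omega
      exact zero_notMem_rookSteps (ha ▸ hl a List.mem_cons_self)
  · rintro rfl
    exact ⟨by simp, rfl⟩

-- Since `p ≠ 0`, a path is nonempty, and it is determined by its first move and the remaining path.
open Classical in
theorem ncard_rookPaths_of_ne_zero (p : Fin 3 →₀ ℕ) (hp : p ≠ 0) :
    (rookPaths p).ncard = ∑ ab ∈ Finset.HasAntidiagonal.antidiagonal p,
      if (ab.1 : Fin 3 → ℕ) ∈ rookSteps then (rookPaths ab.2).ncard else 0 := by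
  set F : (Fin 3 →₀ ℕ) → Finset (List (Fin 3 → ℕ)) := fun p => (rookPaths_finite p).toFinset
    with hF
  have hcard : ∀ p : Fin 3 →₀ ℕ, (rookPaths p).ncard = (F p).card := fun p =>
    Set.ncard_eq_toFinset_card _ _
  have hunion : F p = ((Finset.HasAntidiagonal.antidiagonal p).filter
      fun ab => (ab.1 : Fin 3 → ℕ) ∈ rookSteps).biUnion
        fun ab => (F ab.2).image (List.cons (ab.1 : Fin 3 → ℕ)) := by
    ext l
    simp only [hF, Set.Finite.mem_toFinset, Finset.mem_biUnion, Finset.mem_filter,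
      Finset.HasAntidiagonal.mem_antidiagonal, Finset.mem_image, Prod.exists]
    constructor
    · rintro ⟨hl, hs⟩
      rcases l with _ | ⟨a, t⟩
      · exact absurd (DFunLike.coe_injective hs.symm) hp
      · refine ⟨Finsupp.equivFunOnFinite.symm a, Finsupp.equivFunOnFinite.symm t.sum, ⟨?_, ?_⟩,
          t, ⟨fun s hs => hl s (List.mem_cons_of_mem _ hs), ?_⟩, ?_⟩
        · apply DFunLike.coe_injective
          rw [← hs]
          ext j
          simp
        · exact hl a List.mem_cons_self
        · rfl
        · rfl
    · rintro ⟨a, b, ⟨hab, ha⟩, t, ⟨ht, hs⟩, rfl⟩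
      refine ⟨fun s hs => ?_, ?_⟩
      · rcases List.mem_cons.1 hs with rfl | h
        · exact ha
        · exact ht s h
      · rw [List.sum_cons, hs, ← hab]
        rfl
  rw [hcard, hunion, Finset.card_biUnion, Finset.sum_filter]
  · refine Finset.sum_congr rfl fun ab _ => ?_
    rw [Finset.card_image_of_injective _ (List.cons_injective), hcard]
  · rintro ⟨a, b⟩ hab ⟨a', b'⟩ hab' hne
    simp only [Finset.coe_filter, Finset.HasAntidiagonal.mem_antidiagonal, Set.mem_ofPred_eq]
      at hab hab'
    -- A list determines its head, and the head determines the complementary summand of `p`.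
    rw [Function.onFun, Finset.disjoint_left]
    intro l h1 h2
    obtain ⟨t, -, rfl⟩ := Finset.mem_image.1 h1
    obtain ⟨t', -, h⟩ := Finset.mem_image.1 h2
    have haa : a' = a := DFunLike.coe_injective (List.cons.inj h).1
    subst haa
    exact hne (Prod.ext rfl (add_left_cancel (hab.1.trans hab'.1.symm)))

theorem rookCount_eq : rookCount = 1 + rookStepSeries * rookCount := by
  classical
  ext p
  rw [map_add, MvPowerSeries.coeff_mul, MvPowerSeries.coeff_one]
  change ((rookPaths p).ncard : ℚ) = _ + ∑ ab ∈ Finset.HasAntidiagonal.antidiagonal p,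
    (if (ab.1 : Fin 3 → ℕ) ∈ rookSteps then (1 : ℚ) else 0) * ((rookPaths ab.2).ncard : ℚ)
  rcases eq_or_ne p 0 with rfl | hp
  · simp [rookPaths_zero, zero_notMem_rookSteps]
  · rw [ncard_rookPaths_of_ne_zero p hp, if_neg hp, zero_add]
    push_cast
    refine Finset.sum_congr rfl fun ab _ => ?_
    split_ifs <;> simp

theorem rookStepSeries_eq_sum : rookStepSeries = ∑ i, axisSeries i := by
  classical
  ext p
  rw [map_sum]
  change (if (p : Fin 3 → ℕ) ∈ rookSteps then (1 : ℚ) else 0) =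
    ∑ i, if ∃ m : ℕ, 0 < m ∧ p = Finsupp.single i m then (1 : ℚ) else 0
  by_cases h : (p : Fin 3 → ℕ) ∈ rookSteps
  · rw [if_pos h]
    obtain ⟨i, m, hm, hp⟩ := h
    have hp' : p = Finsupp.single i m := by
      apply DFunLike.coe_injective
      rw [hp, Finsupp.single_eq_pi_single]
    rw [Finset.sum_eq_single i]
    · rw [if_pos ⟨m, hm, hp'⟩]
    · rintro j - hj
      rw [if_neg]
      rintro ⟨m', hm', h'⟩
      rw [hp', Finsupp.single_eq_single_iff] at h'
      rcases h' with ⟨h, -⟩ | ⟨h, -⟩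
      · exact hj h.symm
      · omega
    · simp
  · rw [if_neg h, Finset.sum_eq_zero]
    intro i _
    rw [if_neg]
    rintro ⟨m, hm, rfl⟩
    exact h ⟨i, m, hm, Finsupp.single_eq_pi_single i m⟩

/-- The moves along one axis form the geometric series X/(1-X). Off the axis both sides vanish; on
it the exponents 0, 1 and at least 2 behave differently. -/
theorem one_sub_X_mul_axisSeries (i : Fin 3) :
    (1 - MvPowerSeries.X i) * axisSeries i = MvPowerSeries.X i := by
  classical
  have hcoeff : ∀ p, MvPowerSeries.coeff p (axisSeries i) =
      if ∃ m : ℕ, 0 < m ∧ p = Finsupp.single i m then (1 : ℚ) else 0 := fun p => rfl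
  ext p
  rw [sub_mul, one_mul, map_sub, mul_comm, MvPowerSeries.X, MvPowerSeries.coeff_mul_monomial,
    MvPowerSeries.coeff_monomial, mul_one, hcoeff, hcoeff]
  by_cases h1 : ∃ m, p = Finsupp.single i m
  · obtain ⟨m, rfl⟩ := h1
    rcases m with _ | _ | m
    · rw [if_neg, if_neg, if_neg]
      · simp
      · intro h
        have := DFunLike.congr_fun h i
        simp at this
      · intro h
        have := h i
        simp at this
      · rintro ⟨m, hm, h⟩
        have := DFunLike.congr_fun h i
        simp at this
        omega
    · simp [Finsupp.single_eq_single_iff]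
      intro x hx h
      have := DFunLike.congr_fun h i
      simp at this
      omega
    · have hle : Finsupp.single i 1 ≤ Finsupp.single i (m + 1 + 1) := by simp
      rw [if_pos ⟨m + 2, by omega, rfl⟩, if_pos hle, if_pos ⟨m + 1, by omega,
        by rw [← Finsupp.single_tsub]; rfl⟩, if_neg]
      · simp
      · intro h
        have := DFunLike.congr_fun h i
        simp at this
  · rw [if_neg (fun ⟨m, _, h⟩ => h1 ⟨m, h⟩), if_neg (fun h => h1 ⟨1, h⟩)]
    split_ifs with hle h2
    · obtain ⟨m, _, h2⟩ := h2
      exact absurd ⟨m + 1, by rw [← tsub_add_cancel_of_le hle, h2, ← Finsupp.single_add]⟩ h1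
    · simp
    · simp

/-- The denominator of the rational generating function of rook paths. -/
noncomputable def rookDenom : MvPowerSeries (Fin 3) ℚ :=
  1 - 2 * (MvPowerSeries.X 0 + MvPowerSeries.X 1 + MvPowerSeries.X 2)
    + 3 * (MvPowerSeries.X 0 * MvPowerSeries.X 1 + MvPowerSeries.X 0 * MvPowerSeries.X 2
      + MvPowerSeries.X 1 * MvPowerSeries.X 2)
    - 4 * (MvPowerSeries.X 0 * MvPowerSeries.X 1 * MvPowerSeries.X 2)

theorem rookDenom_mul_rookCount : rookDenom * rookCount =
    (1 - MvPowerSeries.X 0) * (1 - MvPowerSeries.X 1) * (1 - MvPowerSeries.X 2) := by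
  have h := rookCount_eq
  rw [rookStepSeries_eq_sum, Fin.sum_univ_three] at h
  have h0 := one_sub_X_mul_axisSeries 0
  have h1 := one_sub_X_mul_axisSeries 1
  have h2 := one_sub_X_mul_axisSeries 2
  unfold rookDenom
  generalize (MvPowerSeries.X 0 : MvPowerSeries (Fin 3) ℚ) = x at *
  generalize (MvPowerSeries.X 1 : MvPowerSeries (Fin 3) ℚ) = y at *
  generalize (MvPowerSeries.X 2 : MvPowerSeries (Fin 3) ℚ) = z at *
  linear_combination (1 - x) * (1 - y) * (1 - z) * h + rookCount * (1 - y) * (1 - z) * h0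
    + rookCount * (1 - x) * (1 - z) * h1 + rookCount * (1 - x) * (1 - y) * h2

/-! ### Diagonals and Euler derivations -/

/-- The exponent `(n, n, n)`. -/
noncomputable def diagIndex (n : ℕ) : Fin 3 →₀ ℕ := Finsupp.equivFunOnFinite.symm fun _ => n

@[simp]
theorem diagIndex_apply (n : ℕ) (i : Fin 3) : diagIndex n i = n := rfl

/-- The diagonal of a trivariate power series. -/
noncomputable def diag : MvPowerSeries (Fin 3) ℚ →ₗ[ℚ] PowerSeries ℚ where
  toFun f := PowerSeries.mk fun n => MvPowerSeries.coeff (diagIndex n) f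
  map_add' f g := by ext; simp
  map_smul' r f := by ext; simp

theorem coeff_diag (f : MvPowerSeries (Fin 3) ℚ) (n : ℕ) :
    PowerSeries.coeff n (diag f) = MvPowerSeries.coeff (diagIndex n) f := by
  simp [diag]

theorem rookSeries_eq_diag : rookSeries = diag rookCount := by
  ext n
  rw [coeff_diag]
  exact PowerSeries.coeff_mk _ _

/-- The Euler derivation `X i ∂/∂(X i)`. -/
noncomputable def eulerDeriv (i : Fin 3) :
    Derivation ℚ (MvPowerSeries (Fin 3) ℚ) (MvPowerSeries (Fin 3) ℚ) :=
  (MvPowerSeries.X i : MvPowerSeries (Fin 3) ℚ) • MvPowerSeries.pderiv ℚ i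

theorem eulerDeriv_apply (i : Fin 3) (f : MvPowerSeries (Fin 3) ℚ) :
    eulerDeriv i f = MvPowerSeries.X i * MvPowerSeries.pderiv ℚ i f := rfl

theorem coeff_eulerDeriv (i : Fin 3) (f : MvPowerSeries (Fin 3) ℚ) (p : Fin 3 →₀ ℕ) :
    MvPowerSeries.coeff p (eulerDeriv i f) = p i * MvPowerSeries.coeff p f := by
  classical
  rw [eulerDeriv_apply, mul_comm, MvPowerSeries.X, MvPowerSeries.coeff_mul_monomial, mul_one,
    MvPowerSeries.coeff_pderiv]
  split_ifs with h
  · rw [tsub_add_cancel_of_le h, mul_comm]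
    have h1 : 1 ≤ p i := by simpa using h i
    simp [Nat.cast_sub h1]
  · have : p i = 0 := by
      by_contra h0
      exact h (by simpa using Nat.one_le_iff_ne_zero.2 h0)
    simp [this]

theorem eulerDeriv_X (i j : Fin 3) : eulerDeriv i (MvPowerSeries.X j) =
    if i = j then MvPowerSeries.X j else 0 := by
  rw [eulerDeriv_apply]
  split_ifs with h
  · subst h; simp
  · rw [MvPowerSeries.pderiv_X_of_ne (Ne.symm h), mul_zero]

theorem diag_eulerDeriv (i : Fin 3) (f : MvPowerSeries (Fin 3) ℚ) :
    diag (eulerDeriv i f) = PowerSeries.X * PowerSeries.derivative ℚ (diag f) := by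
  ext n
  rw [coeff_diag, coeff_eulerDeriv]
  rcases n with _ | n
  · simp
  · rw [PowerSeries.coeff_succ_X_mul, PowerSeries.coeff_derivative, coeff_diag]
    simp [mul_comm]

theorem diag_X_mul (f : MvPowerSeries (Fin 3) ℚ) :
    diag (MvPowerSeries.X 0 * MvPowerSeries.X 1 * MvPowerSeries.X 2 * f) =
      PowerSeries.X * diag f := by
  classical
  have hm : (MvPowerSeries.X 0 * MvPowerSeries.X 1 * MvPowerSeries.X 2 :
      MvPowerSeries (Fin 3) ℚ) = MvPowerSeries.monomial (diagIndex 1) 1 := by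
    simp only [MvPowerSeries.X, MvPowerSeries.monomial_mul_monomial, mul_one]
    congr 2
    ext i
    fin_cases i <;> simp
  ext n
  rw [coeff_diag, hm, mul_comm, MvPowerSeries.coeff_mul_monomial, mul_one]
  rcases n with _ | n
  · rw [if_neg (fun h => by simpa using h 0)]
    simp
  · have hle : diagIndex 1 ≤ diagIndex (n + 1) := fun i => by simp
    have hsub : diagIndex (n + 1) - diagIndex 1 = diagIndex n := by ext; simp
    rw [PowerSeries.coeff_succ_X_mul, coeff_diag, if_pos hle, hsub]

theorem diag_X_pow_mul (n : ℕ) (f : MvPowerSeries (Fin 3) ℚ) :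
    diag ((MvPowerSeries.X 0 * MvPowerSeries.X 1 * MvPowerSeries.X 2) ^ n * f) =
      PowerSeries.X ^ n * diag f := by
  induction n with
  | zero => simp
  | succ n ih => rw [pow_succ', pow_succ', mul_assoc _ _ f, diag_X_mul, ih, mul_assoc]

/-- Coefficients that are polynomials in t = xyz pass through the diagonal, so the certificates use
only such coefficients. -/
theorem diag_aeval_mul (q : Polynomial ℚ) (f : MvPowerSeries (Fin 3) ℚ) :
    diag (Polynomial.aeval (MvPowerSeries.X 0 * MvPowerSeries.X 1 * MvPowerSeries.X 2) q * f) =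
      Polynomial.aeval (PowerSeries.X : PowerSeries ℚ) q * diag f := by
  induction q using Polynomial.induction_on' with
  | add p q hp hq => simp only [map_add, add_mul, hp, hq]
  | monomial n a =>
    rw [Polynomial.aeval_monomial, Polynomial.aeval_monomial, mul_assoc _ _ f, mul_assoc _ _ (diag f),
      ← Algebra.smul_def, ← Algebra.smul_def, map_smul, diag_X_pow_mul]

/-! ### Telescoping certificates -/

section Certificates

variable {R : Type*} [CommRing R] [Algebra ℚ R]

theorem Derivation.apply_ofNat (θ : Derivation ℚ R R) (n : ℕ) [n.AtLeastTwo] :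
    θ (ofNat(n) : R) = 0 := θ.map_natCast n

/-- The denominator as a polynomial function. -/
def denomPoly (x y z : R) : R :=
  1 - 2 * (x + y + z) + 3 * (x * y + x * z + y * z) - 4 * (x * y * z)

/-- The first component of the certificate of the differential equation of `diag (1 / D)`. -/
def odeCert (x y z : R) : R :=
  let t := x * y * z
  (2 * x - y - z) * (-2 + 172 * t + 379 * t ^ 2 + 2052 * t ^ 3 - 3168 * t ^ 4)
    + (2 * (y * z) - x * y - x * z) * (12 + 27 * t - 336 * t ^ 2 - 3888 * t ^ 3 + 1728 * t ^ 4)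
    + (2 * x ^ 2 - y ^ 2 - z ^ 2) * (-252 * t + 1008 * t ^ 2)
    + (2 * (y ^ 2 * z ^ 2) - x ^ 2 * y ^ 2 - x ^ 2 * z ^ 2) * (-567 * t + 2268 * t ^ 2)
    + (y * z ^ 2 + y ^ 2 * z) * (-18 + 720 * t + 756 * t ^ 2 - 2592 * t ^ 3)
    + (x * z ^ 2 + x * y ^ 2) * (-756 * t + 3024 * t ^ 2)
    + (x ^ 2 * z + x ^ 2 * y) * (18 + 36 * t - 3780 * t ^ 2 + 2592 * t ^ 3)

-- The coefficients in t are invariant under cyclic shifts. The first four brackets each have cyclic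
-- sum zero; the last three share one cyclic sum, and their coefficients add up to zero.
omit [Algebra ℚ R] in
theorem odeCert_add (x y z : R) : odeCert x y z + odeCert y z x + odeCert z x y = 0 := by
  unfold odeCert; ring

/-- The first component of the certificate relating the diagonals of `N / D` and `1 / D`. -/
def numCert (x y z : R) : R :=
  2 * (y * z) - x * y - x * z + x * y * z * (8 * x - 4 * y - 4 * z)

variable (θ : Fin 3 → Derivation ℚ R R) {x y z I : R}

-- `S` becomes 3x d/dx on diagonals, which accounts for the factors 3 and 9: after division by 9 the
-- left side is `odeOp`. Over the common denominator D³ the claim is a polynomial identity.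
set_option maxRecDepth 4000 in
theorem ode_certificate (hx : ∀ i, θ i x = if i = 0 then x else 0)
    (hy : ∀ i, θ i y = if i = 1 then y else 0) (hz : ∀ i, θ i z = if i = 2 then z else 0)
    (hI : denomPoly x y z * I = 1) :
    let t := x * y * z
    let S : R → R := fun f => θ 0 f + θ 1 f + θ 2 f
    (-2 + 121 * t + 475 * t ^ 2 - 1746 * t ^ 3 + 1152 * t ^ 4) * S (S I)
      + 3 * (145 * t - 646 * t ^ 2 - 1362 * t ^ 3 + 2304 * t ^ 4) * S I
      + 9 * (32 * t - 368 * t ^ 2 - 228 * t ^ 3 + 1152 * t ^ 4) * I =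
    θ 0 (odeCert x y z * I ^ 2) + θ 1 (odeCert y z x * I ^ 2) + θ 2 (odeCert z x y * I ^ 2) := by
  intro t S
  have ht : t = x * y * z := rfl
  clear_value t
  -- Homogenization: every term is rewritten as I³ times a polynomial.
  have hI1 : I = I ^ 3 * denomPoly x y z ^ 2 := by
    linear_combination (-I - I ^ 2 * denomPoly x y z) * hI
  have hI2 : I ^ 2 = I ^ 3 * denomPoly x y z := by linear_combination (-I ^ 2) * hI
  have hθI : ∀ i, θ i I = -I ^ 2 * θ i (denomPoly x y z) := fun i =>
    (θ i).leibniz_of_mul_eq_one (by rw [mul_comm]; exact hI)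
  have hcert : ∀ i w, θ i (w * I ^ 2) =
      I ^ 3 * (θ i w * denomPoly x y z - 2 * w * θ i (denomPoly x y z)) := fun i w => by
    simp only [Derivation.leibniz, Derivation.leibniz_pow, hθI, smul_eq_mul, nsmul_eq_mul]
    push_cast
    linear_combination θ i w * hI2
  have hSI : S I = -I ^ 2 * S (denomPoly x y z) := by simp only [S, hθI]; ring
  have hSmul : ∀ f, S (-I ^ 2 * f) = 2 * I ^ 3 * S (denomPoly x y z) * f - I ^ 2 * S f := by
    intro f
    simp only [S, Derivation.leibniz, Derivation.leibniz_pow, hθI, smul_eq_mul, nsmul_eq_mul,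
      map_neg]
    push_cast
    ring
  have hSSI : S (S I) = I ^ 3 * (2 * S (denomPoly x y z) ^ 2
      - S (S (denomPoly x y z)) * denomPoly x y z) := by
    rw [hSI, hSmul]
    linear_combination (-S (S (denomPoly x y z))) * hI2
  have hD : S (denomPoly x y z) =
      -2 * (x + y + z) + 6 * (x * y + x * z + y * z) - 12 * (x * y * z) := by
    simp [S, denomPoly, hx, hy, hz, Derivation.apply_ofNat]
    ring
  have hSD : S (S (denomPoly x y z)) =
      -2 * (x + y + z) + 12 * (x * y + x * z + y * z) - 36 * (x * y * z) := by
    rw [hD]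
    simp [S, hx, hy, hz, Derivation.apply_ofNat]
    ring
  have hD0 : θ 0 (denomPoly x y z) = -2 * x + 3 * (x * y + x * z) - 4 * (x * y * z) := by
    simp [denomPoly, hx, hy, hz, Derivation.apply_ofNat]
    ring
  have hD1 : θ 1 (denomPoly x y z) = -2 * y + 3 * (x * y + y * z) - 4 * (x * y * z) := by
    simp [denomPoly, hx, hy, hz, Derivation.apply_ofNat]
    ring
  have hD2 : θ 2 (denomPoly x y z) = -2 * z + 3 * (x * z + y * z) - 4 * (x * y * z) := by
    simp [denomPoly, hx, hy, hz, Derivation.apply_ofNat]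
  have hlhs : S I = I ^ 3 * (-S (denomPoly x y z) * denomPoly x y z) := by
    rw [hSI]
    linear_combination (-S (denomPoly x y z)) * hI2
  rw [hcert, hcert, hcert, hSSI, hlhs, hSD, hD, hD0, hD1, hD2]
  simp only [odeCert, Derivation.leibniz, Derivation.leibniz_pow, map_add, map_sub, map_neg, hx,
    hy, hz, smul_eq_mul, nsmul_eq_mul, Derivation.apply_ofNat, Fin.isValue, Fin.reduceEq, if_true,
    if_false, Nat.cast_ofNat, Nat.reduceSub, pow_one]
  rw [denomPoly] at hI1 ⊢
  subst ht
  linear_combination (9 * (32 * (x * y * z) - 368 * (x * y * z) ^ 2 - 228 * (x * y * z) ^ 3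
    + 1152 * (x * y * z) ^ 4)) * hI1

theorem num_certificate (hx : ∀ i, θ i x = if i = 0 then x else 0)
    (hy : ∀ i, θ i y = if i = 1 then y else 0) (hz : ∀ i, θ i z = if i = 2 then z else 0)
    (hI : denomPoly x y z * I = 1) :
    let t := x * y * z
    let S : R → R := fun f => θ 0 f + θ 1 f + θ 2 f
    2 * (1 + 6 * t) * S ((1 - x) * (1 - y) * (1 - z) * I)
      - ((1 - t) * (1 - 4 * t) * S I - 12 * (1 - t) * t * I) =
    θ 0 (numCert x y z * I) + θ 1 (numCert y z x * I) + θ 2 (numCert z x y * I) := by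
  intro t S
  have hI1 : I = I ^ 2 * denomPoly x y z := by linear_combination (-I) * hI
  have hθI : ∀ i, θ i I = -I ^ 2 * θ i (denomPoly x y z) := fun i =>
    (θ i).leibniz_of_mul_eq_one (by rw [mul_comm]; exact hI)
  have hcert : ∀ i w, θ i (w * I) =
      I ^ 2 * (θ i w * denomPoly x y z - w * θ i (denomPoly x y z)) := fun i w => by
    simp only [Derivation.leibniz, hθI, smul_eq_mul]
    linear_combination θ i w * hI1
  simp only [S, t, hcert, hθI]
  rw [denomPoly] at hI1
  simp only [denomPoly, numCert, Derivation.leibniz, map_add, map_sub, hx,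
    hy, hz, smul_eq_mul, Derivation.apply_ofNat, Fin.isValue, Fin.reduceEq, if_true,
    if_false, Derivation.map_one_eq_zero]
  linear_combination (12 * (1 - x * y * z) * (x * y * z)) * hI1

end Certificates

/-! ### Differential relations for the diagonals -/

/-- The diagonal of `1 / D`. -/
noncomputable def diagInv : PowerSeries ℚ := diag rookDenom⁻¹

theorem constantCoeff_rookDenom : MvPowerSeries.constantCoeff rookDenom = 1 := by
  simp [rookDenom]

theorem rookDenom_mul_inv : rookDenom * rookDenom⁻¹ = 1 :=
  MvPowerSeries.mul_inv_cancel _ (by rw [constantCoeff_rookDenom]; exact one_ne_zero)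

theorem constantCoeff_diagInv : PowerSeries.constantCoeff diagInv = 1 := by
  have h0 : diagIndex 0 = 0 := by ext; simp
  rw [← PowerSeries.coeff_zero_eq_constantCoeff_apply, diagInv, coeff_diag, h0,
    MvPowerSeries.coeff_zero_eq_constantCoeff_apply, MvPowerSeries.constantCoeff_inv,
    constantCoeff_rookDenom, inv_one]

/-- The Euler operator `x d/dx` on power series. -/
noncomputable def euler (f : PowerSeries ℚ) : PowerSeries ℚ :=
  PowerSeries.X * PowerSeries.derivative ℚ f

/-- A second order differential operator with a regular singular point at `0`. -/
noncomputable def odeOp (f : PowerSeries ℚ) : PowerSeries ℚ :=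
  (-2 + 121 * PowerSeries.X + 475 * PowerSeries.X ^ 2 - 1746 * PowerSeries.X ^ 3
      + 1152 * PowerSeries.X ^ 4) * euler (euler f)
    + (145 * PowerSeries.X - 646 * PowerSeries.X ^ 2 - 1362 * PowerSeries.X ^ 3
      + 2304 * PowerSeries.X ^ 4) * euler f
    + (32 * PowerSeries.X - 368 * PowerSeries.X ^ 2 - 228 * PowerSeries.X ^ 3
      + 1152 * PowerSeries.X ^ 4) * f

theorem diag_sum_eulerDeriv (f : MvPowerSeries (Fin 3) ℚ) :
    diag (eulerDeriv 0 f + eulerDeriv 1 f + eulerDeriv 2 f) = 3 * euler (diag f) := by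
  rw [map_add, map_add, diag_eulerDeriv, diag_eulerDeriv, diag_eulerDeriv, euler]
  ring

theorem diag_exact {a b c : MvPowerSeries (Fin 3) ℚ} (h : a + b + c = 0) :
    diag (eulerDeriv 0 a + eulerDeriv 1 b + eulerDeriv 2 c) = 0 := by
  rw [map_add, map_add, diag_eulerDeriv, diag_eulerDeriv, diag_eulerDeriv, ← mul_add, ← mul_add,
    ← map_add, ← map_add, ← map_add, ← map_add, h, map_zero, map_zero, mul_zero]

/-- Makes the numerals 3, 9 and 144 that are cancelled below nonzero. -/
instance : CharZero (PowerSeries ℚ) :=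
  charZero_of_injective_algebraMap (algebraMap ℚ (PowerSeries ℚ)).injective

theorem odeOp_diagInv : odeOp diagInv = 0 := by
  have h := congrArg diag (ode_certificate eulerDeriv (eulerDeriv_X · 0) (eulerDeriv_X · 1)
    (eulerDeriv_X · 2) rookDenom_mul_inv)
  rw [diag_exact (by rw [← add_mul, ← add_mul, odeCert_add, zero_mul])] at h
  have h2 := diag_aeval_mul (-2 + 121 * Polynomial.X + 475 * Polynomial.X ^ 2
    - 1746 * Polynomial.X ^ 3 + 1152 * Polynomial.X ^ 4)
  have h1 := diag_aeval_mul (3 * (145 * Polynomial.X - 646 * Polynomial.X ^ 2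
    - 1362 * Polynomial.X ^ 3 + 2304 * Polynomial.X ^ 4))
  have h0 := diag_aeval_mul (9 * (32 * Polynomial.X - 368 * Polynomial.X ^ 2
    - 228 * Polynomial.X ^ 3 + 1152 * Polynomial.X ^ 4))
  simp only [map_add, map_sub, map_mul, map_neg, map_pow, Polynomial.aeval_X, map_ofNat]
    at h0 h1 h2
  have h3 : ∀ f, euler (3 * f) = 3 * euler f := fun f => by
    simp [euler, Derivation.apply_ofNat, mul_left_comm]
  rw [map_add, map_add, h0, h1, h2, diag_sum_eulerDeriv, diag_sum_eulerDeriv, h3] at h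
  have h9 : (9 : PowerSeries ℚ) ≠ 0 := by norm_num
  refine mul_left_cancel₀ h9 ?_
  rw [mul_zero, ← h, odeOp, diagInv]
  ring

theorem derivative_rookSeries : 2 * (1 + 6 * PowerSeries.X) * PowerSeries.derivative ℚ rookSeries =
    (1 - PowerSeries.X) * ((1 - 4 * PowerSeries.X) * PowerSeries.derivative ℚ diagInv
      - 4 * diagInv) := by
  have hR : rookCount = (1 - MvPowerSeries.X 0) * (1 - MvPowerSeries.X 1) *
      (1 - MvPowerSeries.X 2) * rookDenom⁻¹ := by
    linear_combination rookDenom⁻¹ * rookDenom_mul_rookCount - rookCount * rookDenom_mul_inv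
  have h := congrArg diag (num_certificate eulerDeriv (eulerDeriv_X · 0) (eulerDeriv_X · 1)
    (eulerDeriv_X · 2) rookDenom_mul_inv)
  simp only [← hR] at h
  rw [diag_exact (by unfold numCert; ring), map_sub, map_sub] at h
  have h2 := diag_aeval_mul (2 * (1 + 6 * Polynomial.X))
  have h1 := diag_aeval_mul ((1 - Polynomial.X) * (1 - 4 * Polynomial.X))
  have h0 := diag_aeval_mul (12 * (1 - Polynomial.X) * Polynomial.X)
  simp only [map_add, map_sub, map_mul, map_one, Polynomial.aeval_X, map_ofNat] at h0 h1 h2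
  rw [h0, h1, h2, diag_sum_eulerDeriv, diag_sum_eulerDeriv, ← rookSeries_eq_diag] at h
  -- Both occurrences of 3x d/dx, and the remaining term 12(1-x)x, contain the factor 3x.
  have h3 : (3 * PowerSeries.X : PowerSeries ℚ) ≠ 0 :=
    mul_ne_zero (by norm_num) PowerSeries.X_ne_zero
  refine mul_left_cancel₀ h3 ?_
  rw [euler, euler] at h
  rw [diagInv]
  linear_combination h

/-! ### Uniqueness of the power series solution -/

theorem coeff_euler (f : PowerSeries ℚ) (n : ℕ) :
    PowerSeries.coeff n (euler f) = n * PowerSeries.coeff n f := by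
  rcases n with _ | n
  · simp [euler]
  · rw [euler, PowerSeries.coeff_succ_X_mul, PowerSeries.coeff_derivative]
    push_cast
    ring

theorem X_pow_dvd_euler {f : PowerSeries ℚ} {n : ℕ} (h : PowerSeries.X ^ n ∣ f) :
    PowerSeries.X ^ n ∣ euler f := by
  rw [PowerSeries.X_pow_dvd_iff] at h ⊢
  intro m hm
  rw [coeff_euler, h m hm, mul_zero]

/-- A solution of the differential equation is determined by its constant coefficient. -/
theorem eq_zero_of_odeOp {f : PowerSeries ℚ} (hf : odeOp f = 0)
    (h0 : PowerSeries.constantCoeff f = 0) : f = 0 := by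
  have key : ∀ n, PowerSeries.X ^ n ∣ f := by
    intro n
    induction n with
    | zero => simp
    | succ n ih =>
      have h1 := X_pow_dvd_euler ih
      have h2 := X_pow_dvd_euler h1
      -- All of the equation except -2(x d/dx)²f carries a factor x, so divisibility improves by
      -- one. Then 2m² times the m-th coefficient vanishes, which settles every m except 0.
      have hdvd : PowerSeries.X ^ (n + 1) ∣ PowerSeries.C 2 * euler (euler f) := by
        have : PowerSeries.C 2 * euler (euler f) = PowerSeries.X *
            ((121 + 475 * PowerSeries.X - 1746 * PowerSeries.X ^ 2
              + 1152 * PowerSeries.X ^ 3) * euler (euler f)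
            + (145 - 646 * PowerSeries.X - 1362 * PowerSeries.X ^ 2
              + 2304 * PowerSeries.X ^ 3) * euler f
            + (32 - 368 * PowerSeries.X - 228 * PowerSeries.X ^ 2
              + 1152 * PowerSeries.X ^ 3) * f) := by
          rw [odeOp] at hf
          rw [show PowerSeries.C (2 : ℚ) = 2 from map_ofNat _ 2]
          linear_combination -hf
        rw [this, pow_succ']
        exact mul_dvd_mul_left _ (dvd_add (dvd_add (dvd_mul_of_dvd_right h2 _)
          (dvd_mul_of_dvd_right h1 _)) (dvd_mul_of_dvd_right ih _))
      rw [PowerSeries.X_pow_dvd_iff] at hdvd ih ⊢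
      intro m hm
      rcases Nat.lt_succ_iff_lt_or_eq.1 hm with hm' | rfl
      · exact ih m hm'
      · rcases m with _ | m
        · simpa using h0
        · have := hdvd _ hm
          rw [PowerSeries.coeff_C_mul, coeff_euler, coeff_euler] at this
          simpa [Nat.cast_add_one_ne_zero] using this
  ext n
  exact (PowerSeries.X_pow_dvd_iff.1 (key (n + 1))) n (Nat.lt_succ_self n)

theorem odeOp_sub (f g : PowerSeries ℚ) : odeOp (f - g) = odeOp f - odeOp g := by
  simp only [odeOp, euler, map_sub, mul_sub, Derivation.leibniz, smul_eq_mul]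
  ring

theorem odeOp_eq (f : PowerSeries ℚ) : odeOp f = PowerSeries.X *
    (PowerSeries.X * (-2 + 121 * PowerSeries.X + 475 * PowerSeries.X ^ 2 - 1746 * PowerSeries.X ^ 3
        + 1152 * PowerSeries.X ^ 4) * PowerSeries.derivative ℚ (PowerSeries.derivative ℚ f)
      + (-2 + 266 * PowerSeries.X - 171 * PowerSeries.X ^ 2 - 3108 * PowerSeries.X ^ 3
        + 3456 * PowerSeries.X ^ 4) * PowerSeries.derivative ℚ f
      + (32 - 368 * PowerSeries.X - 228 * PowerSeries.X ^ 2 + 1152 * PowerSeries.X ^ 3) * f) := by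
  simp only [odeOp, euler, Derivation.leibniz, smul_eq_mul, PowerSeries.derivative_X]
  ring

/-! ### The hypergeometric equation and its pullback -/

theorem hypergeometricCoefficient_succ (a b : ℚ) (n : ℕ) :
    ordinaryHypergeometricCoefficient a b 1 (n + 1) * (n + 1) ^ 2 =
      (a + n) * (b + n) * ordinaryHypergeometricCoefficient a b 1 n := by
  have h1 : (ascPochhammer ℚ n).eval 1 ≠ 0 := by
    rw [ascPochhammer_eval_one]; exact_mod_cast n.factorial_ne_zero
  have hn : (n : ℚ) + 1 ≠ 0 := by positivity
  have hn' : 1 + (n : ℚ) ≠ 0 := by positivity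
  have hf : (n.factorial : ℚ) ≠ 0 := by exact_mod_cast n.factorial_ne_zero
  simp only [ordinaryHypergeometricCoefficient, ascPochhammer_succ_eval, Nat.factorial_succ]
  push_cast
  field_simp
  ring

theorem hypergeometricSeries_ode :
    144 * (PowerSeries.X * (1 - PowerSeries.X) * PowerSeries.derivative ℚ
        (PowerSeries.derivative ℚ (hypergeometricSeries (1 / 12) (5 / 12) 1)))
      + (144 - 216 * PowerSeries.X) *
        PowerSeries.derivative ℚ (hypergeometricSeries (1 / 12) (5 / 12) 1)
      - 5 * hypergeometricSeries (1 / 12) (5 / 12) 1 = 0 := by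
  set F := hypergeometricSeries (1 / 12) (5 / 12) 1 with hF
  have hc : ∀ n, PowerSeries.coeff n F = ordinaryHypergeometricCoefficient (1 / 12) (5 / 12) 1 n :=
    fun n => PowerSeries.coeff_mk _ _
  -- The coefficient recursion in operator form, with θ = x d/dx: 144θ²F = x(12θ + 1)(12θ + 5)F.
  have e : PowerSeries.C 144 * (euler (euler F))
      = PowerSeries.X * (PowerSeries.C 144 * euler (euler F) + PowerSeries.C 72 * euler F
        + PowerSeries.C 5 * F) := by
    ext n
    rcases n with _ | n
    · simp [coeff_euler]
    · rw [PowerSeries.coeff_succ_X_mul]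
      simp only [map_add, PowerSeries.coeff_C_mul, coeff_euler, hc]
      have := hypergeometricCoefficient_succ (1 / 12) (5 / 12) n
      push_cast
      linear_combination 144 * this
  refine mul_left_cancel₀ (PowerSeries.X_ne_zero (R := ℚ)) ?_
  rw [show PowerSeries.C (144 : ℚ) = 144 from map_ofNat _ 144,
    show PowerSeries.C (72 : ℚ) = 72 from map_ofNat _ 72,
    show PowerSeries.C (5 : ℚ) = 5 from map_ofNat _ 5] at e
  simp only [euler, Derivation.leibniz, smul_eq_mul, PowerSeries.derivative_X] at e
  linear_combination e

theorem hasSubst_sub_one {f : PowerSeries ℚ} (hf : PowerSeries.constantCoeff f = 1) :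
    PowerSeries.HasSubst (f - 1) :=
  PowerSeries.HasSubst.of_constantCoeff_zero' (by simp [hf])

/-- By the addition law for binomial series, four exponents -1/4 and one exponent 1 cancel. -/
theorem seriesRpow_neg_quarter_pow {f : PowerSeries ℚ} (hf : PowerSeries.constantCoeff f = 1) :
    seriesRpow f (-1 / 4) ^ 4 * f = 1 := by
  have hs := hasSubst_sub_one hf
  have hb : PowerSeries.binomialSeries ℚ (-1 / 4 : ℚ) ^ 4 * (1 + PowerSeries.X) = 1 := by
    have h1 : (1 + PowerSeries.X : PowerSeries ℚ) = PowerSeries.binomialSeries ℚ (1 : ℚ) := by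
      simpa using (PowerSeries.binomialSeries_nat (R := ℚ) (A := ℚ) 1).symm
    rw [h1, show (4 : ℕ) = 1 + 1 + 1 + 1 from rfl, pow_add, pow_add, pow_add, pow_one,
      ← PowerSeries.binomialSeries_add, ← PowerSeries.binomialSeries_add,
      ← PowerSeries.binomialSeries_add, ← PowerSeries.binomialSeries_add]
    norm_num
  have h := congrArg (PowerSeries.subst (f - 1)) hb
  have hone : PowerSeries.subst (f - 1) (1 : PowerSeries ℚ) = 1 := by
    rw [← PowerSeries.coe_substAlgHom hs, map_one]
  rw [PowerSeries.subst_mul hs, PowerSeries.subst_pow hs, PowerSeries.subst_add hs,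
    PowerSeries.subst_X hs, hone, add_sub_cancel] at h
  exact h

theorem four_mul_derivative_seriesRpow {f γ : PowerSeries ℚ}
    (hf : PowerSeries.constantCoeff f = 1) (hγ : f * γ = 1) :
    4 * PowerSeries.derivative ℚ (seriesRpow f (-1 / 4)) =
      -seriesRpow f (-1 / 4) * γ * PowerSeries.derivative ℚ f := by
  have h := seriesRpow_neg_quarter_pow hf
  set w := seriesRpow f (-1 / 4)
  have hd := congrArg (PowerSeries.derivative ℚ) h
  simp only [Derivation.leibniz, Derivation.leibniz_pow, smul_eq_mul, nsmul_eq_mul,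
    Derivation.map_one_eq_zero, Nat.cast_ofNat, Nat.reduceSub] at hd
  linear_combination w * hd - 4 * PowerSeries.derivative ℚ w * h
    - w * PowerSeries.derivative ℚ f * (γ * h - w ^ 4 * hγ)

/-- For y = w F(z) with w = g^(-1/4) and z = d/g³, the expression 144(P₂y'' + P₁y' + P₀y) equals w r
γ² times the hypergeometric equation at z. Here m is the numerator of z' over g⁴. Matching the
coefficients of F'', F and F' gives the denominator-free conditions `hm`, `h0` and `h1`. -/
theorem pullback_ode {A : Type*} [CommRing A]
    {g g1 g2 d m m1 r P0 P1 P2 γ w w1 w2 z z1 z2 F0 F1 F2 : A} (hγ : g * γ = 1)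
    (hw1 : 4 * w1 = -w * γ * g1) (hw2 : 16 * w2 = 5 * w * γ ^ 2 * g1 ^ 2 - 4 * w * γ * g2)
    (hz : z = d * γ ^ 3) (hz1 : z1 = m * γ ^ 4) (hz2 : z2 = m1 * γ ^ 4 - 4 * m * γ ^ 5 * g1)
    (hF : 144 * (z * (1 - z) * F2) + (144 - 216 * z) * F1 - 5 * F0 = 0)
    (hm : P2 * m ^ 2 = (g ^ 3 - d) * d * r)
    (h0 : 9 * P2 * (5 * g1 ^ 2 - 4 * g2 * g) + 5 * r - 36 * P1 * g1 * g + 144 * P0 * g ^ 2 = 0)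
    (h1 : -72 * P2 * g1 * m + 144 * P2 * (m1 * g - 4 * m * g1) - 144 * r * g ^ 3 + 216 * r * d
      + 144 * P1 * m * g = 0) :
    144 * (P2 * (w2 * F0 + 2 * w1 * F1 * z1 + w * F2 * z1 ^ 2 + w * F1 * z2)
      + P1 * (w1 * F0 + w * F1 * z1) + P0 * (w * F0)) = 0 := by
  subst hz hz1 hz2
  linear_combination 9 * P2 * F0 * hw2 + (72 * P2 * F1 * m * γ ^ 4 + 36 * P1 * F0) * hw1
    + w * r * γ ^ 2 * hF + 144 * w * F2 * γ ^ 8 * hm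
    + w * F0 * γ ^ 2 * h0 + w * F1 * γ ^ 5 * h1
    + (w * F0 * (36 * P2 * g2 * γ + 36 * P1 * g1 * γ - 144 * P0 * (g * γ + 1))
      - w * F1 * (144 * P2 * m1 * γ ^ 4 + 144 * P1 * m * γ ^ 4
        - 144 * r * γ ^ 2 * (g ^ 2 * γ ^ 2 + g * γ + 1))
      + 144 * w * r * F2 * d * γ ^ 5 * (g ^ 2 * γ ^ 2 + g * γ + 1)) * hγ

theorem constantCoeff_g₂ : PowerSeries.constantCoeff (g₂ (PowerSeries.X : PowerSeries ℚ)) = 1 := by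
  simp [g₂]

theorem constantCoeff_g₂_pow :
    PowerSeries.constantCoeff (g₂ (PowerSeries.X : PowerSeries ℚ) ^ 3) ≠ 0 := by
  rw [map_pow, constantCoeff_g₂]; norm_num

theorem constantCoeff_invJSeries : PowerSeries.constantCoeff invJSeries = 0 := by
  simp [invJSeries, denJ]

theorem hasSubst_invJSeries : PowerSeries.HasSubst invJSeries :=
  PowerSeries.HasSubst.of_constantCoeff_zero' constantCoeff_invJSeries

theorem constantCoeff_subst_of_eq_one {f h : PowerSeries ℚ}
    (hf : PowerSeries.constantCoeff f = 1) (hh : PowerSeries.constantCoeff h = 0) :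
    PowerSeries.constantCoeff (f.subst h : PowerSeries ℚ) = 1 := by
  have hs := PowerSeries.HasSubst.of_constantCoeff_zero' hh
  have h0 : PowerSeries.constantCoeff ((f - 1).subst h : PowerSeries ℚ) = 0 :=
    PowerSeries.constantCoeff_subst_eq_zero hh (f - 1) (by simp [hf])
  rw [← PowerSeries.coe_substAlgHom hs, map_sub, map_sub, map_one,
    PowerSeries.coe_substAlgHom hs, PowerSeries.constantCoeff_one, sub_eq_zero] at h0
  exact h0

theorem constantCoeff_seriesRpow {f : PowerSeries ℚ} (hf : PowerSeries.constantCoeff f = 1)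
    (r : ℚ) : PowerSeries.constantCoeff (seriesRpow f r) = 1 :=
  constantCoeff_subst_of_eq_one (by simp) (by simp [hf])

theorem constantCoeff_beukersHSeries : PowerSeries.constantCoeff beukersHSeries = 1 := by
  rw [beukersHSeries, map_mul, constantCoeff_seriesRpow constantCoeff_g₂,
    constantCoeff_subst_of_eq_one _ constantCoeff_invJSeries, mul_one]
  simp [hypergeometricSeries, ordinaryHypergeometricCoefficient]

theorem odeOp_beukersHSeries : odeOp beukersHSeries = 0 := by
  set g : PowerSeries ℚ := g₂ PowerSeries.X with hg
  obtain ⟨γ, hγ⟩ : ∃ γ, g * γ = 1 := ⟨g⁻¹, PowerSeries.mul_inv_cancel _ (by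
    rw [constantCoeff_g₂]; exact one_ne_zero)⟩
  have hz : invJSeries = denJ PowerSeries.X * γ ^ 3 := by
    rw [invJSeries, ← hg]
    congr 1
    rw [eq_comm, PowerSeries.eq_inv_iff_mul_eq_one constantCoeff_g₂_pow, ← mul_pow, mul_comm γ, hγ,
      one_pow]
  have hγd : PowerSeries.derivative ℚ γ = -γ ^ 2 * PowerSeries.derivative ℚ g :=
    Derivation.leibniz_of_mul_eq_one _ (by rw [mul_comm]; exact hγ)
  have hw := four_mul_derivative_seriesRpow constantCoeff_g₂ hγ
  rw [← hg] at hw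
  have hF := congrArg (PowerSeries.subst invJSeries) hypergeometricSeries_ode
  have hs := hasSubst_invJSeries
  simp only [← PowerSeries.coe_substAlgHom hs, map_add, map_sub, map_mul, map_one, map_ofNat,
    map_zero, PowerSeries.substAlgHom_X hs] at hF
  simp only [PowerSeries.coe_substAlgHom hs] at hF
  set F := hypergeometricSeries (1 / 12) (5 / 12) 1 with hFdef
  have hd0 := PowerSeries.derivative_subst (f := F) hs
  have hd1 := PowerSeries.derivative_subst (f := PowerSeries.derivative ℚ F) hs
  have hw2 : 16 * PowerSeries.derivative ℚ (PowerSeries.derivative ℚ (seriesRpow g (-1 / 4))) =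
      5 * seriesRpow g (-1 / 4) * γ ^ 2 * PowerSeries.derivative ℚ g ^ 2
        - 4 * seriesRpow g (-1 / 4) * γ * PowerSeries.derivative ℚ (PowerSeries.derivative ℚ g) := by
    have h := congrArg (PowerSeries.derivative ℚ) hw
    simp only [Derivation.leibniz, smul_eq_mul, Derivation.apply_ofNat, map_neg, hγd] at h
    linear_combination 4 * h - γ * PowerSeries.derivative ℚ g * hw
  have hg' : g = 1 - 64 * PowerSeries.X + 360 * PowerSeries.X ^ 2 - 544 * PowerSeries.X ^ 3
      + 256 * PowerSeries.X ^ 4 := by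
    rw [hg, g₂]; ring
  have hg1 : PowerSeries.derivative ℚ g = -64 + 720 * PowerSeries.X - 1632 * PowerSeries.X ^ 2
      + 1024 * PowerSeries.X ^ 3 := by
    rw [hg']
    simp [Derivation.leibniz_pow, Derivation.apply_ofNat]
    ring
  have hg2 : PowerSeries.derivative ℚ (PowerSeries.derivative ℚ g) =
      720 - 3264 * PowerSeries.X + 3072 * PowerSeries.X ^ 2 := by
    rw [hg1]
    simp [Derivation.leibniz_pow, Derivation.apply_ofNat]
    ring
  set d : PowerSeries ℚ := denJ PowerSeries.X with hd
  have hd' : d = 13824 * PowerSeries.X ^ 3 - 974592 * PowerSeries.X ^ 4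
        + 5982336 * PowerSeries.X ^ 5 - 15114816 * PowerSeries.X ^ 6
        + 19097856 * PowerSeries.X ^ 7 - 11990592 * PowerSeries.X ^ 8
        + 2985984 * PowerSeries.X ^ 9 := by
    rw [hd, denJ]; ring
  have hdd : PowerSeries.derivative ℚ d = 41472 * PowerSeries.X ^ 2 - 3898368 * PowerSeries.X ^ 3
        + 29911680 * PowerSeries.X ^ 4 - 90688896 * PowerSeries.X ^ 5
        + 133684992 * PowerSeries.X ^ 6 - 95924736 * PowerSeries.X ^ 7
        + 26873856 * PowerSeries.X ^ 8 := by
    rw [hd']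
    simp [Derivation.leibniz_pow, Derivation.apply_ofNat]
    ring
  -- m = d'g - 3dg', expanded, and kept opaque so that it acts as an atom.
  obtain ⟨m, hm⟩ : ∃ m : PowerSeries ℚ, m = 41472 * PowerSeries.X ^ 2 - 3898368 * PowerSeries.X ^ 3
        + 77355648 * PowerSeries.X ^ 4 - 109600128 * PowerSeries.X ^ 5
        - 1800652032 * PowerSeries.X ^ 6 + 10028551680 * PowerSeries.X ^ 7
        - 24648634368 * PowerSeries.X ^ 8 + 34214980608 * PowerSeries.X ^ 9
        - 27743275008 * PowerSeries.X ^ 10 + 12278366208 * PowerSeries.X ^ 11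
        - 2293235712 * PowerSeries.X ^ 12 := ⟨_, rfl⟩
  have hmd : PowerSeries.derivative ℚ m = 82944 * PowerSeries.X - 11695104 * PowerSeries.X ^ 2
        + 309422592 * PowerSeries.X ^ 3 - 548000640 * PowerSeries.X ^ 4
        - 10803912192 * PowerSeries.X ^ 5 + 70199861760 * PowerSeries.X ^ 6
        - 197189074944 * PowerSeries.X ^ 7 + 307934825472 * PowerSeries.X ^ 8
        - 277432750080 * PowerSeries.X ^ 9 + 135062028288 * PowerSeries.X ^ 10
        - 27518828544 * PowerSeries.X ^ 11 := by
    rw [hm]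
    simp [Derivation.leibniz_pow, Derivation.apply_ofNat]
    ring
  have hz1 : PowerSeries.derivative ℚ invJSeries = m * γ ^ 4 := by
    have hmeq : m = PowerSeries.derivative ℚ d * g - 3 * d * PowerSeries.derivative ℚ g := by
      rw [hm, hdd, hg1, hd', hg']; ring
    rw [hz, hmeq]
    simp only [Derivation.leibniz, Derivation.leibniz_pow, smul_eq_mul, nsmul_eq_mul,
      Nat.cast_ofNat, Nat.reduceSub, hγd]
    linear_combination (-γ ^ 3 * PowerSeries.derivative ℚ d) * hγ
  have hz2 : PowerSeries.derivative ℚ (PowerSeries.derivative ℚ invJSeries) =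
      PowerSeries.derivative ℚ m * γ ^ 4 - 4 * m * γ ^ 5 * PowerSeries.derivative ℚ g := by
    rw [hz1]
    simp only [Derivation.leibniz, Derivation.leibniz_pow, smul_eq_mul, nsmul_eq_mul,
      Nat.cast_ofNat, Nat.reduceSub, hγd]
    ring
  -- The condition on F'' forces r = P₂m²/((g³ - d)d), which is a polynomial.
  have key := pullback_ode (r := -248832 * PowerSeries.X ^ 2 - 3483648 * PowerSeries.X ^ 3
        - 10264320 * PowerSeries.X ^ 4 + 30792960 * PowerSeries.X ^ 5
        + 83980800 * PowerSeries.X ^ 6 - 221709312 * PowerSeries.X ^ 7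
        + 120932352 * PowerSeries.X ^ 8)
    (P2 := PowerSeries.X * (-2 + 121 * PowerSeries.X + 475 * PowerSeries.X ^ 2
      - 1746 * PowerSeries.X ^ 3 + 1152 * PowerSeries.X ^ 4))
    (P1 := -2 + 266 * PowerSeries.X - 171 * PowerSeries.X ^ 2 - 3108 * PowerSeries.X ^ 3
      + 3456 * PowerSeries.X ^ 4)
    (P0 := 32 - 368 * PowerSeries.X - 228 * PowerSeries.X ^ 2 + 1152 * PowerSeries.X ^ 3)
    hγ hw hw2 hz hz1 hz2 hF (by rw [hm, hg', hd']; ring) (by rw [hg2, hg1, hg']; ring)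
    (by rw [hmd, hm, hg1, hg', hd']; ring)
  have h144 : (144 : PowerSeries ℚ) ≠ 0 := by norm_num
  have key' := mul_left_cancel₀ h144 (key.trans (mul_zero _).symm)
  rw [odeOp_eq, beukersHSeries, ← hg, ← hFdef]
  refine mul_eq_zero_of_right _ ?_
  rw [← key']
  simp only [Derivation.leibniz, smul_eq_mul, map_add, hd0, hd1]
  ring

theorem diagInv_eq_beukersHSeries : diagInv = beukersHSeries := by
  refine sub_eq_zero.1 (eq_zero_of_odeOp ?_ ?_)
  · rw [odeOp_sub, odeOp_diagInv, odeOp_beukersHSeries, sub_zero]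
  · rw [map_sub, constantCoeff_diagInv, constantCoeff_beukersHSeries, sub_self]

theorem rookSeries_formula : PowerSeries.derivative ℚ rookSeries =
    (1 - PowerSeries.X) * (2 * (1 + 6 * PowerSeries.X))⁻¹ *
      ((1 - 4 * PowerSeries.X) * PowerSeries.derivative ℚ beukersHSeries
        - 4 * beukersHSeries) := by
  have h := derivative_rookSeries
  rw [diagInv_eq_beukersHSeries] at h
  have hc : PowerSeries.constantCoeff (2 * (1 + 6 * PowerSeries.X) : PowerSeries ℚ) ≠ 0 := by
    rw [map_mul, map_ofNat]
    simp
  have hi := PowerSeries.mul_inv_cancel _ hc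
  linear_combination (2 * (1 + 6 * PowerSeries.X) : PowerSeries ℚ)⁻¹ * h
    - PowerSeries.derivative ℚ rookSeries * hi

/-! ### Taylor series of analytic functions -/

/-- The Taylor series at `0` of a function of a complex variable. -/
noncomputable def taylorSeries (f : ℂ → ℂ) : PowerSeries ℂ :=
  PowerSeries.mk fun n => iteratedDeriv n f 0 / n.factorial

section TaylorSeries

variable {f g : ℂ → ℂ}

theorem coeff_taylorSeries (f : ℂ → ℂ) (n : ℕ) :
    PowerSeries.coeff n (taylorSeries f) = iteratedDeriv n f 0 / n.factorial :=
  PowerSeries.coeff_mk _ _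

theorem constantCoeff_taylorSeries (f : ℂ → ℂ) :
    PowerSeries.constantCoeff (taylorSeries f) = f 0 := by
  rw [← PowerSeries.coeff_zero_eq_constantCoeff_apply, coeff_taylorSeries]
  simp

theorem hasFPowerSeriesAt_taylorSeries (hf : AnalyticAt ℂ f 0) : HasFPowerSeriesAt f
    (FormalMultilinearSeries.ofScalars ℂ fun n => PowerSeries.coeff n (taylorSeries f)) 0 := by
  simpa only [coeff_taylorSeries] using hf.hasFPowerSeriesAt

theorem coeff_taylorSeries_of_hasFPowerSeriesAt {c : ℕ → ℂ}
    (hf : HasFPowerSeriesAt f (FormalMultilinearSeries.ofScalars ℂ c) 0) (n : ℕ) :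
    PowerSeries.coeff n (taylorSeries f) = c n :=
  congrFun (FormalMultilinearSeries.ofScalars_series_injective ℂ ℂ
    ((hasFPowerSeriesAt_taylorSeries hf.analyticAt).eq_formalMultilinearSeries hf)) n

theorem taylorSeries_congr (h : f =ᶠ[nhds 0] g) : taylorSeries f = taylorSeries g := by
  ext n
  rw [coeff_taylorSeries, coeff_taylorSeries, h.iteratedDeriv_eq]

theorem eventuallyEq_of_taylorSeries_eq (hf : AnalyticAt ℂ f 0) (hg : AnalyticAt ℂ g 0)
    (h : taylorSeries f = taylorSeries g) : f =ᶠ[nhds 0] g := by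
  have hs := (hasFPowerSeriesAt_taylorSeries hf).sub (hasFPowerSeriesAt_taylorSeries hg)
  rw [h, sub_self] at hs
  filter_upwards [hs.eventually_eq_zero] with x hx
  exact sub_eq_zero.1 hx

theorem taylorSeries_add (hf : AnalyticAt ℂ f 0) (hg : AnalyticAt ℂ g 0) :
    taylorSeries (fun x => f x + g x) = taylorSeries f + taylorSeries g := by
  ext n
  rw [map_add, coeff_taylorSeries, coeff_taylorSeries, coeff_taylorSeries, ← add_div]
  congr 1
  exact iteratedDeriv_add hf.contDiffAt hg.contDiffAt

theorem taylorSeries_mul (hf : AnalyticAt ℂ f 0) (hg : AnalyticAt ℂ g 0) :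
    taylorSeries (fun x => f x * g x) = taylorSeries f * taylorSeries g := by
  ext n
  rw [PowerSeries.coeff_mul, Finset.Nat.sum_antidiagonal_eq_sum_range_succ_mk, coeff_taylorSeries,
    show (fun x => f x * g x) = f * g from rfl, iteratedDeriv_mul hf.contDiffAt hg.contDiffAt,
    Finset.sum_div]
  refine Finset.sum_congr rfl fun i hi => ?_
  have hi' : i ≤ n := Nat.lt_succ_iff.1 (Finset.mem_range.1 hi)
  rw [coeff_taylorSeries, coeff_taylorSeries, Nat.cast_choose ℂ hi']
  have h1 : (n.factorial : ℂ) ≠ 0 := by exact_mod_cast n.factorial_ne_zero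
  have h2 : (i.factorial : ℂ) ≠ 0 := by exact_mod_cast i.factorial_ne_zero
  have h3 : ((n - i).factorial : ℂ) ≠ 0 := by exact_mod_cast (n - i).factorial_ne_zero
  field_simp

theorem taylorSeries_pow (hf : AnalyticAt ℂ f 0) (n : ℕ) :
    taylorSeries (fun x => f x ^ n) = taylorSeries f ^ n := by
  induction n with
  | zero =>
    ext n
    rw [coeff_taylorSeries, pow_zero, PowerSeries.coeff_one]
    simp only [pow_zero, iteratedDeriv_const]
    split_ifs with h <;> simp [h]
  | succ n ih =>
    simp only [pow_succ]
    rw [taylorSeries_mul (hf.fun_pow n) hf, ih]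

theorem taylorSeries_const (c : ℂ) : taylorSeries (fun _ => c) = PowerSeries.C c := by
  ext n
  rw [coeff_taylorSeries, iteratedDeriv_const, PowerSeries.coeff_C]
  split_ifs with h <;> simp [h]

theorem taylorSeries_deriv (f : ℂ → ℂ) :
    taylorSeries (deriv f) = PowerSeries.derivative ℂ (taylorSeries f) := by
  ext n
  rw [PowerSeries.coeff_derivative, coeff_taylorSeries, coeff_taylorSeries, iteratedDeriv_succ',
    Nat.factorial_succ]
  have h1 : (n.factorial : ℂ) ≠ 0 := by exact_mod_cast n.factorial_ne_zero
  have h2 : (n : ℂ) + 1 ≠ 0 := by exact_mod_cast n.succ_ne_zero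
  push_cast
  field_simp

theorem analyticAt_self {z : ℂ} : AnalyticAt ℂ (fun x : ℂ => x) z := analyticAt_id

theorem taylorSeries_id : taylorSeries (fun x => x) = PowerSeries.X := by
  refine PowerSeries.derivative.ext ?_ ?_
  · rw [← taylorSeries_deriv, PowerSeries.derivative_X]
    simp [taylorSeries_const]
  · simp [constantCoeff_taylorSeries]

theorem analyticAt_polynomial (p : Polynomial ℂ) (z : ℂ) : AnalyticAt ℂ (fun x => p.eval x) z :=
  p.differentiable.analyticAt z

theorem taylorSeries_polynomial (p : Polynomial ℂ) :
    taylorSeries (fun x => p.eval x) = (p : PowerSeries ℂ) := by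
  induction p using Polynomial.induction_on' with
  | add p q hp hq =>
    simp only [Polynomial.eval_add]
    rw [taylorSeries_add (analyticAt_polynomial p 0) (analyticAt_polynomial q 0), hp, hq,
      Polynomial.coe_add]
  | monomial n a =>
    simp only [Polynomial.eval_monomial]
    rw [taylorSeries_mul analyticAt_const (analyticAt_self.fun_pow n), taylorSeries_const,
      taylorSeries_pow analyticAt_self, taylorSeries_id, ← Polynomial.C_mul_X_pow_eq_monomial]
    simp

theorem taylorSeries_comp (hg : AnalyticAt ℂ g 0) (hg0 : g 0 = 0) (hf : AnalyticAt ℂ f 0) :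
    taylorSeries (fun x => f (g x)) = (taylorSeries f).subst (taylorSeries g) := by
  have hc : PowerSeries.constantCoeff (taylorSeries g) = 0 := by
    rw [constantCoeff_taylorSeries, hg0]
  have hs : PowerSeries.HasSubst (taylorSeries g) := PowerSeries.HasSubst.of_constantCoeff_zero' hc
  -- Induction over all analytic `f` at once: writing f(x) = f(0) + x·`dslope f 0 x` passes to the
  -- slope and gains a factor g, whose Taylor series is divisible by X.
  have key : ∀ n : ℕ, ∀ f : ℂ → ℂ, AnalyticAt ℂ f 0 → PowerSeries.X ^ n ∣
      taylorSeries (fun x => f (g x)) - (taylorSeries f).subst (taylorSeries g) := by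
    intro n
    induction n with
    | zero => simp
    | succ n ih =>
      intro f hf
      obtain ⟨p, hp⟩ := hf
      have h1 : AnalyticAt ℂ (dslope f 0) 0 := hp.has_fpower_series_dslope_fslope.analyticAt
      have hfd : f = fun x => f 0 + x * dslope f 0 x := by
        funext x
        have := sub_smul_dslope f 0 x
        rw [sub_zero, smul_eq_mul] at this
        rw [this]
        ring
      have hcomp : AnalyticAt ℂ (fun x => dslope f 0 (g x)) 0 :=
        AnalyticAt.fun_comp (by rwa [hg0]) hg
      have e1 : taylorSeries f = PowerSeries.C (f 0) + PowerSeries.X * taylorSeries (dslope f 0) := by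
        conv_lhs => rw [hfd]
        rw [taylorSeries_add analyticAt_const (analyticAt_self.fun_mul h1), taylorSeries_const,
          taylorSeries_mul analyticAt_self h1, taylorSeries_id]
      have e2 : taylorSeries (fun x => f (g x)) =
          PowerSeries.C (f 0) + taylorSeries g * taylorSeries (fun x => dslope f 0 (g x)) := by
        conv_lhs => rw [hfd]
        rw [taylorSeries_add analyticAt_const (hg.fun_mul hcomp), taylorSeries_const,
          taylorSeries_mul hg hcomp]
      have hC : PowerSeries.subst (taylorSeries g) (PowerSeries.C (f 0)) = PowerSeries.C (f 0) :=
        PowerSeries.subst_C _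
      rw [e1, e2, PowerSeries.subst_add hs, PowerSeries.subst_mul hs, PowerSeries.subst_X hs, hC,
        add_sub_add_left_eq_sub, ← mul_sub, pow_succ']
      exact mul_dvd_mul (PowerSeries.X_dvd_iff.2 hc) (ih _ h1)
  ext n
  have := PowerSeries.X_pow_dvd_iff.1 (key (n + 1) f hf) n (Nat.lt_succ_self n)
  rwa [map_sub, sub_eq_zero] at this

end TaylorSeries

/-! ### The Taylor series of H -/

theorem map_g₂ {R S : Type*} [CommRing R] [CommRing S] (φ : R →+* S) (x : R) :
    φ (g₂ x) = g₂ (φ x) := by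
  simp only [g₂, map_mul, map_sub, map_add, map_pow, map_one, map_ofNat]

theorem map_denJ {R S : Type*} [CommRing R] [CommRing S] (φ : R →+* S) (x : R) :
    φ (denJ x) = denJ (φ x) := by
  simp only [denJ, map_mul, map_sub, map_pow, map_one, map_ofNat]

theorem g₂_eq_eval (x : ℂ) : g₂ x = (g₂ Polynomial.X : Polynomial ℂ).eval x := by
  rw [← Polynomial.coe_evalRingHom, map_g₂]; simp

theorem denJ_eq_eval (x : ℂ) : denJ x = (denJ Polynomial.X : Polynomial ℂ).eval x := by
  rw [← Polynomial.coe_evalRingHom, map_denJ]; simp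

theorem analyticAt_g₂ (z : ℂ) : AnalyticAt ℂ (fun x : ℂ => g₂ x) z := by
  simp only [g₂_eq_eval]; exact analyticAt_polynomial _ _

theorem analyticAt_denJ (z : ℂ) : AnalyticAt ℂ (fun x : ℂ => denJ x) z := by
  simp only [denJ_eq_eval]; exact analyticAt_polynomial _ _

theorem taylorSeries_g₂ : taylorSeries (fun x => g₂ x) = g₂ PowerSeries.X := by
  simp only [g₂_eq_eval]
  rw [taylorSeries_polynomial, ← Polynomial.coeToPowerSeries.ringHom_apply, map_g₂]
  simp

theorem taylorSeries_denJ : taylorSeries (fun x => denJ x) = denJ PowerSeries.X := by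
  simp only [denJ_eq_eval]
  rw [taylorSeries_polynomial, ← Polynomial.coeToPowerSeries.ringHom_apply, map_denJ]
  simp

theorem g₂_zero : g₂ (0 : ℂ) = 1 := by simp [g₂]

theorem eventually_g₂_ne_zero : ∀ᶠ x in nhds (0 : ℂ), g₂ x ≠ 0 :=
  (analyticAt_g₂ 0).continuousAt.eventually_ne (by rw [g₂_zero]; exact one_ne_zero)

theorem one_div_beukersJ (x : ℂ) : 1 / beukersJ x = denJ x / g₂ x ^ 3 := by
  rw [beukersJ, one_div_div]

theorem analyticAt_one_div_beukersJ : AnalyticAt ℂ (fun x => 1 / beukersJ x) 0 := by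
  simp only [one_div_beukersJ]
  exact (analyticAt_denJ 0).div ((analyticAt_g₂ 0).fun_pow 3) (by simp [g₂_zero])

/-- Base change of power series from `ℚ` to `ℂ`. -/
noncomputable def toComplexSeries : PowerSeries ℚ →+* PowerSeries ℂ :=
  PowerSeries.map (algebraMap ℚ ℂ)

theorem toComplexSeries_X : toComplexSeries PowerSeries.X = PowerSeries.X :=
  PowerSeries.map_X _

theorem taylorSeries_one_div_beukersJ :
    taylorSeries (fun x => 1 / beukersJ x) = toComplexSeries invJSeries := by
  have h1 : taylorSeries (fun x => 1 / beukersJ x) * g₂ PowerSeries.X ^ 3 = denJ PowerSeries.X := by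
    rw [← taylorSeries_g₂, ← taylorSeries_denJ, ← taylorSeries_pow (analyticAt_g₂ 0),
      ← taylorSeries_mul analyticAt_one_div_beukersJ ((analyticAt_g₂ 0).fun_pow 3)]
    refine taylorSeries_congr ?_
    filter_upwards [eventually_g₂_ne_zero] with x hx
    rw [one_div_beukersJ, div_mul_cancel₀ _ (pow_ne_zero 3 hx)]
  have h2 : toComplexSeries invJSeries * g₂ PowerSeries.X ^ 3 = denJ PowerSeries.X := by
    rw [← toComplexSeries_X, ← map_g₂, ← map_denJ, ← map_pow, ← map_mul, invJSeries, mul_assoc,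
      PowerSeries.inv_mul_cancel _ constantCoeff_g₂_pow, mul_one]
  have hg : (g₂ PowerSeries.X : PowerSeries ℂ) ^ 3 ≠ 0 := by
    intro h
    have := congrArg PowerSeries.constantCoeff h
    simp [g₂] at this
  exact mul_right_cancel₀ hg (h1.trans h2.symm)

theorem ordinaryHypergeometricCoefficient_cast (a b c : ℚ) (n : ℕ) :
    ordinaryHypergeometricCoefficient (a : ℂ) b c n =
      algebraMap ℚ ℂ (ordinaryHypergeometricCoefficient a b c n) := by
  have h : ∀ q : ℚ, (ascPochhammer ℂ n).eval (q : ℂ) =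
      algebraMap ℚ ℂ ((ascPochhammer ℚ n).eval q) := fun q => by
    rw [← ascPochhammer_map (algebraMap ℚ ℂ)]
    exact Polynomial.eval_map_apply (algebraMap ℚ ℂ) q
  simp only [ordinaryHypergeometricCoefficient, h]
  simp

theorem hasFPowerSeriesAt_hypergeometric :
    HasFPowerSeriesAt (ordinaryHypergeometric (1 / 12 : ℂ) (5 / 12) 1)
      (FormalMultilinearSeries.ofScalars ℂ
        (ordinaryHypergeometricCoefficient (1 / 12 : ℂ) (5 / 12) 1)) 0 := by
  have hr : 0 < (ordinaryHypergeometricSeries ℂ (1 / 12 : ℂ) (5 / 12) 1).radius := by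
    rw [ordinaryHypergeometricSeries_radius_eq_one]
    · exact zero_lt_one
    -- Radius one requires that no parameter be a nonpositive integer; all three are positive.
    · intro k
      have hpos : ∀ q : ℝ, 0 < q → (k : ℂ) ≠ -(q : ℂ) := fun q hq h => by
        have := congrArg Complex.re h
        simp at this
        have hk : (0 : ℝ) ≤ k := k.cast_nonneg
        linarith
      refine ⟨?_, ?_, ?_⟩
      · simpa using hpos (1 / 12) (by norm_num)
      · simpa using hpos (5 / 12) (by norm_num)
      · simpa using hpos 1 (by norm_num)
  exact (FormalMultilinearSeries.hasFPowerSeriesOnBall _ hr).hasFPowerSeriesAt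

theorem taylorSeries_hypergeometric :
    taylorSeries (ordinaryHypergeometric (1 / 12 : ℂ) (5 / 12) 1) =
      toComplexSeries (hypergeometricSeries (1 / 12) (5 / 12) 1) := by
  ext n
  rw [coeff_taylorSeries_of_hasFPowerSeriesAt hasFPowerSeriesAt_hypergeometric, toComplexSeries,
    PowerSeries.coeff_map, hypergeometricSeries, PowerSeries.coeff_mk,
    ← ordinaryHypergeometricCoefficient_cast]
  norm_num

theorem analyticAt_g₂_cpow : AnalyticAt ℂ (fun x : ℂ => 1 / g₂ x ^ (1 / 4 : ℂ)) 0 :=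
  analyticAt_const.div ((analyticAt_g₂ 0).cpow analyticAt_const (by simp [g₂_zero]))
    (by simp [g₂_zero])

/-- The cofactor (a + b)(a² + b²) of a - b has constant term 4. This identifies the principal branch
with the binomial series. -/
theorem eq_of_pow_four_eq {a b : PowerSeries ℂ} (h : a ^ 4 = b ^ 4)
    (ha : PowerSeries.constantCoeff a = 1) (hb : PowerSeries.constantCoeff b = 1) : a = b := by
  have h4 : (a - b) * ((a + b) * (a ^ 2 + b ^ 2)) = 0 := by linear_combination h
  refine sub_eq_zero.1 ((mul_eq_zero.1 h4).resolve_right fun h0 => ?_)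
  have := congrArg PowerSeries.constantCoeff h0
  simp [ha, hb] at this

theorem taylorSeries_g₂_cpow : taylorSeries (fun x : ℂ => 1 / g₂ x ^ (1 / 4 : ℂ)) =
    toComplexSeries (seriesRpow (g₂ PowerSeries.X) (-1 / 4)) := by
  have h1 : taylorSeries (fun x : ℂ => 1 / g₂ x ^ (1 / 4 : ℂ)) ^ 4 * g₂ PowerSeries.X = 1 := by
    rw [← taylorSeries_g₂, ← taylorSeries_pow analyticAt_g₂_cpow,
      ← taylorSeries_mul (analyticAt_g₂_cpow.fun_pow 4) (analyticAt_g₂ 0),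
      ← map_one (PowerSeries.C (R := ℂ)), ← taylorSeries_const]
    refine taylorSeries_congr ?_
    filter_upwards [eventually_g₂_ne_zero] with x hx
    have h4 : (g₂ x ^ (1 / 4 : ℂ)) ^ 4 = g₂ x := by
      simp
    rw [div_pow, one_pow, h4, one_div, inv_mul_cancel₀ hx]
  have h2 : toComplexSeries (seriesRpow (g₂ PowerSeries.X) (-1 / 4)) ^ 4 * g₂ PowerSeries.X = 1 := by
    rw [← toComplexSeries_X, ← map_g₂, ← map_pow, ← map_mul,
      seriesRpow_neg_quarter_pow constantCoeff_g₂, map_one]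
  have hg : (g₂ PowerSeries.X : PowerSeries ℂ) ≠ 0 := by
    intro h
    have := congrArg PowerSeries.constantCoeff h
    simp [g₂] at this
  refine eq_of_pow_four_eq (mul_right_cancel₀ hg (h1.trans h2.symm)) ?_ ?_
  · simp [constantCoeff_taylorSeries, g₂_zero]
  · rw [toComplexSeries, ← PowerSeries.coeff_zero_eq_constantCoeff_apply, PowerSeries.coeff_map,
      PowerSeries.coeff_zero_eq_constantCoeff_apply, constantCoeff_seriesRpow constantCoeff_g₂,
      map_one]

theorem one_div_beukersJ_zero : 1 / beukersJ 0 = 0 := by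
  rw [one_div_beukersJ]; simp [denJ]

theorem analyticAt_hypergeometric_comp : AnalyticAt ℂ
    (fun x => ordinaryHypergeometric (1 / 12 : ℂ) (5 / 12) 1 (1 / beukersJ x)) 0 := by
  refine AnalyticAt.fun_comp (g := ordinaryHypergeometric (1 / 12 : ℂ) (5 / 12) 1) ?_
    analyticAt_one_div_beukersJ
  rw [one_div_beukersJ_zero]
  exact hasFPowerSeriesAt_hypergeometric.analyticAt

theorem analyticAt_beukersH : AnalyticAt ℂ beukersH 0 :=
  analyticAt_g₂_cpow.mul analyticAt_hypergeometric_comp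

theorem taylorSeries_beukersH : taylorSeries beukersH = toComplexSeries beukersHSeries := by
  have h := taylorSeries_mul analyticAt_g₂_cpow analyticAt_hypergeometric_comp
  rw [taylorSeries_g₂_cpow, taylorSeries_comp analyticAt_one_div_beukersJ one_div_beukersJ_zero
    hasFPowerSeriesAt_hypergeometric.analyticAt, taylorSeries_hypergeometric,
    taylorSeries_one_div_beukersJ] at h
  rw [beukersHSeries, map_mul]
  refine h.trans ?_
  congr 1
  exact (PowerSeries.map_subst hasSubst_invJSeries _).symm

/-! ### Convergence of G and its derivative -/

theorem toComplexSeries_derivative (f : PowerSeries ℚ) :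
    toComplexSeries (PowerSeries.derivative ℚ f) =
      PowerSeries.derivative ℂ (toComplexSeries f) := by
  ext n
  simp [toComplexSeries, PowerSeries.coeff_derivative]

/-- The analytic function that is the derivative of `rookFun` near `0`. -/
noncomputable def rookDerivFun (x : ℂ) : ℂ :=
  (1 - x) / (2 * (1 + 6 * x)) * ((1 - 4 * x) * deriv beukersH x - 4 * beukersH x)

theorem analyticAt_rookDerivFun : AnalyticAt ℂ rookDerivFun 0 := by
  have h1 := analyticAt_beukersH
  have h2 := h1.deriv
  have h3 : AnalyticAt ℂ (fun x : ℂ => (1 - x) / (2 * (1 + 6 * x))) 0 := by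
    refine AnalyticAt.div (by fun_prop) (by fun_prop) (by simp)
  exact h3.mul (((by fun_prop : AnalyticAt ℂ (fun x : ℂ => 1 - 4 * x) 0).mul h2).sub
    (analyticAt_const.mul h1))

theorem taylorSeries_rookDerivFun : taylorSeries rookDerivFun =
    toComplexSeries (PowerSeries.derivative ℚ rookSeries) := by
  have hH := analyticAt_beukersH
  have hpoly : ∀ p q : Polynomial ℂ, taylorSeries (fun x => p.eval x * deriv beukersH x
      + q.eval x * beukersH x) = p * PowerSeries.derivative ℂ (taylorSeries beukersH)
        + q * taylorSeries beukersH := fun p q => by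
    rw [taylorSeries_add ((analyticAt_polynomial p 0).fun_mul hH.deriv)
      ((analyticAt_polynomial q 0).fun_mul hH), taylorSeries_mul (analyticAt_polynomial p 0) hH.deriv,
      taylorSeries_mul (analyticAt_polynomial q 0) hH, taylorSeries_polynomial,
      taylorSeries_polynomial, taylorSeries_deriv]
  have h1 : ((2 * (1 + 6 * Polynomial.X) : Polynomial ℂ) : PowerSeries ℂ) *
      taylorSeries rookDerivFun =
      (((1 - Polynomial.X) * (1 - 4 * Polynomial.X) : Polynomial ℂ) : PowerSeries ℂ) *
        PowerSeries.derivative ℂ (taylorSeries beukersH)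
      + ((-4 * (1 - Polynomial.X) : Polynomial ℂ) : PowerSeries ℂ) * taylorSeries beukersH := by
    rw [← hpoly, ← taylorSeries_polynomial,
      ← taylorSeries_mul (analyticAt_polynomial _ 0) analyticAt_rookDerivFun]
    refine taylorSeries_congr ?_
    have hne : ∀ᶠ x in nhds (0 : ℂ), 1 + 6 * x ≠ 0 :=
      (by fun_prop : ContinuousAt (fun x : ℂ => 1 + 6 * x) 0).eventually_ne (by simp)
    filter_upwards [hne] with x hx
    simp [rookDerivFun]
    field_simp
    ring
  have h2 := congrArg toComplexSeries derivative_rookSeries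
  rw [diagInv_eq_beukersHSeries] at h2
  simp only [map_mul, map_add, map_sub, map_one, map_ofNat, toComplexSeries_X,
    toComplexSeries_derivative, ← taylorSeries_beukersH] at h2
  simp only [← Polynomial.coeToPowerSeries.ringHom_apply, map_mul, map_add, map_sub, map_one,
    map_neg, map_ofNat] at h1
  simp only [Polynomial.coeToPowerSeries.ringHom_apply, Polynomial.coe_X] at h1
  have hne : (2 * (1 + 6 * PowerSeries.X) : PowerSeries ℂ) ≠ 0 := by
    intro h
    have := congrArg PowerSeries.constantCoeff h
    rw [map_mul, map_ofNat] at this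
    simp at this
  refine mul_left_cancel₀ hne ?_
  rw [toComplexSeries_derivative]
  linear_combination h1 - h2

theorem coeff_taylorSeries_rookDerivFun (n : ℕ) :
    PowerSeries.coeff n (taylorSeries rookDerivFun) = (diagonalRook (n + 1) : ℂ) * (n + 1) := by
  rw [taylorSeries_rookDerivFun, toComplexSeries, PowerSeries.coeff_map,
    PowerSeries.coeff_derivative, rookSeries, PowerSeries.coeff_mk]
  simp

/-- The series `∑ aₙ xⁿ` as a formal multilinear series. -/
noncomputable def rookFormalSeries : FormalMultilinearSeries ℂ ℂ ℂ :=
  FormalMultilinearSeries.ofScalars ℂ fun n => (diagonalRook n : ℂ)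

theorem rookFormalSeries_radius_pos : 0 < rookFormalSeries.radius := by
  have hp := (hasFPowerSeriesAt_taylorSeries analyticAt_rookDerivFun).radius_pos
  obtain ⟨r, hr0, hr⟩ := ENNReal.lt_iff_exists_nnreal_btwn.1 hp
  obtain ⟨C, hC, hbound⟩ := FormalMultilinearSeries.norm_mul_pow_le_of_lt_radius _ hr
  refine lt_of_lt_of_le hr0 (FormalMultilinearSeries.le_radius_of_bound _
    -- The bound (n+1)aₙ₊₁rⁿ ≤ C yields aₙ₊₁rⁿ⁺¹ ≤ Cr; a₀, invisible to the derivative, is bounded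
    -- separately.
    (max (diagonalRook 0 : ℝ) (C * r)) fun n => ?_)
  rw [rookFormalSeries, FormalMultilinearSeries.ofScalars_norm, Complex.norm_natCast]
  rcases n with _ | n
  · simp
  · refine le_trans ?_ (le_max_right _ _)
    have h := hbound n
    rw [FormalMultilinearSeries.ofScalars_norm, coeff_taylorSeries_rookDerivFun, norm_mul,
      Complex.norm_natCast, ← Nat.cast_succ, Complex.norm_natCast] at h
    have h1 : (1 : ℝ) ≤ (n.succ : ℝ) := by exact_mod_cast Nat.succ_pos n
    rw [pow_succ, ← mul_assoc]
    refine mul_le_mul_of_nonneg_right (le_trans ?_ h) r.coe_nonneg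
    refine mul_le_mul_of_nonneg_right ?_ (pow_nonneg r.coe_nonneg n)
    exact le_mul_of_one_le_right (Nat.cast_nonneg _) h1

theorem rookFun_eq_sum : rookFun = rookFormalSeries.sum := by
  funext x
  simp [rookFun, rookFormalSeries, FormalMultilinearSeries.sum, mul_comm]

theorem hasFPowerSeriesOnBall_rookFun :
    HasFPowerSeriesOnBall rookFun rookFormalSeries 0 rookFormalSeries.radius :=
  rookFun_eq_sum ▸ FormalMultilinearSeries.hasFPowerSeriesOnBall _ rookFormalSeries_radius_pos

theorem eventually_summable_rook :
    ∀ᶠ x in nhds (0 : ℂ), Summable fun n : ℕ => (diagonalRook n : ℂ) * x ^ n := by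
  filter_upwards [Metric.eball_mem_nhds (0 : ℂ) rookFormalSeries_radius_pos] with x hx
  have := (hasFPowerSeriesOnBall_rookFun.hasSum hx).summable
  simpa [rookFormalSeries, mul_comm] using this

theorem deriv_rookFun_eventuallyEq : deriv rookFun =ᶠ[nhds 0] rookDerivFun := by
  have hG := hasFPowerSeriesOnBall_rookFun.hasFPowerSeriesAt
  refine eventuallyEq_of_taylorSeries_eq hG.analyticAt.deriv analyticAt_rookDerivFun ?_
  ext n
  rw [taylorSeries_deriv, PowerSeries.coeff_derivative, coeff_taylorSeries_rookDerivFun,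
    coeff_taylorSeries_of_hasFPowerSeriesAt hG]

theorem mainTheorem5 :
    (PowerSeries.derivative ℚ rookSeries =
      (1 - PowerSeries.X) * (2 * (1 + 6 * PowerSeries.X))⁻¹ *
        ((1 - 4 * PowerSeries.X) * PowerSeries.derivative ℚ beukersHSeries - 4 * beukersHSeries)) ∧
    (∀ᶠ x in nhds (0 : ℂ),
      Summable (fun n : ℕ => (diagonalRook n : ℂ) * x ^ n) ∧
      DifferentiableAt ℂ beukersH x ∧
      HasDerivAt rookFun
        ((1 - x) / (2 * (1 + 6 * x)) * ((1 - 4 * x) * deriv beukersH x - 4 * beukersH x)) x) := by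
  refine ⟨rookSeries_formula, ?_⟩
  filter_upwards [eventually_summable_rook, analyticAt_beukersH.eventually_analyticAt,
    hasFPowerSeriesOnBall_rookFun.analyticAt.eventually_analyticAt,
    deriv_rookFun_eventuallyEq] with x hs hH hG hd
  refine ⟨hs, hH.differentiableAt, ?_⟩
  have := hG.differentiableAt.hasDerivAt
  rwa [hd] at this
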